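/- Let $(G,K)$ be a Riemannian symmetric pair of compact type: $G$ is a connected Lie group whose Lie algebra $\mathfrak g$ has negative definite Killing form, $\sigma$ is a smooth automorphism of $G$ with $\sigma^2=\mathrm{id}$, and $K$ is a closed subgroup of $G$ contained in the fixed point group $G^\sigma$ and containing the identity component of $G^\sigma$. (For instance, $G=I_0(M)$ is the identity component of the isometry group of an irreducible symmetric space $M$ of compact type and $K$ is the stabilizer of a point.) Let $\mathfrak p$ be the $(-1)$-eigenspace of $d\sigma$ on $\mathfrak g$, with the Euclidean structure given by minus the Killing form, and let $\mathfrak h_{\mathfrak p}\subseteq\mathfrak p$ be a maximal abelian subspace. For $\alpha\in\mathfrak h_{\mathfrak p}^*$ put $$\mathfrak g(\alpha)=\{X\in\mathfrak g \mid [H,[H,X]]=-\alpha(H)^2X\ \text{ for all } H\in\mathfrak h_{\mathfrak p}\},\qquad \mathfrak p(\alpha)=\mathfrak g(\alpha)\cap\mathfrak p .$$ Let $\Sigma=\{\alpha\in\mathfrak h_{\mathfrak p}^*\mid \alpha\neq0,\ \mathfrak g(\alpha)\neq0\}$ be the restricted root system and $\Sigma^+\subseteq\Sigma$ a set of positive roots,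 that is, for each $\alpha\in\Sigma$ exactly one of $\alpha,-\alpha$ lies in $\Sigma^+$, and $\alpha+\beta\in\Sigma^+$ whenever $\alpha,\beta\in\Sigma^+$ and $\alpha+\beta\in\Sigma$. Let $\mathbf x\in\mathfrak h_{\mathfrak p}$. Then the sum of the subspaces $\mathfrak p(\alpha)$ over the $\alpha\in\Sigma^+$ with $\alpha(\mathbf x)\neq0$ is direct, and $$T_{\mathbf x}\big(\mathrm{Ad}(K)\mathbf x\big)=p_0^{\mathbf x}\Big(\bigoplus_{\alpha\in\Sigma^+,\ \alpha(\mathbf x)\neq0}\mathfrak p(\alpha)\Big).$$ Here the left side is the tangent space at $\mathbf x$ of the orbit $\mathrm{Ad}(K)\mathbf x\subseteq\mathfrak p$, i.e. the set of velocities at $\mathbf x$ of smooth curves in $\mathfrak p$ that stay in the orbit, and $p_0^{\mathbf x}\colon T_0\mathfrak p\to T_{\mathbf x}\mathfrak p$ is Euclidean parallel translation, with $\mathfrak p$ identified with $T_0\mathfrak p$ in the natural way. -/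

import Mathlib

open scoped Manifold ContDiff Topology

noncomputable section

/-- Over `ℝ`, the smoothness exponent needed for the Lie bracket is at most `∞`. -/
instance leInfty_minSmoothness_real_three : ENat.LEInfty (minSmoothness ℝ 3) :=
  ⟨by
    rw [minSmoothness_of_isRCLikeNormedField]
    exact (inferInstance : ENat.LEInfty (3 : WithTop ℕ∞)).out⟩

/-! ### Tangent spaces of subsets of a Euclidean space, and parallel translation -/

section Euclidean

variable {V : Type*} [NormedAddCommGroup V] [NormedSpace ℝ V]

/-- The tangent space at `x` of a submanifold `S` of a vector space `V`, as a subset of `T_x V`: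
the velocities at time `0` of the smooth curves in `V` that run inside `S` and start at `x`. -/
def submanifoldTangentSpace (S : Set V) (x : V) : Set (TangentSpace 𝓘(ℝ, V) x) :=
  {v | ∃ γ : ℝ → V, ContDiff ℝ ∞ γ ∧ (∀ t, γ t ∈ S) ∧ γ 0 = x ∧
    HasDerivAt γ (NormedSpace.fromTangentSpace (𝕜 := ℝ) x v) 0}

/-- Euclidean parallel translation `T_a V → T_b V`. -/
def euclideanParallelTransport (a b : V) :
    TangentSpace 𝓘(ℝ, V) a →L[ℝ] TangentSpace 𝓘(ℝ, V) b :=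
  ((NormedSpace.fromTangentSpace (𝕜 := ℝ) b).symm : V →L[ℝ] TangentSpace 𝓘(ℝ, V) b).comp
    (NormedSpace.fromTangentSpace (𝕜 := ℝ) a : TangentSpace 𝓘(ℝ, V) a →L[ℝ] V)

/-- The natural identification of a subspace of `V` with a subspace of `T_0 V`. -/
def Submodule.atZero (W : Submodule ℝ V) : Submodule ℝ (TangentSpace 𝓘(ℝ, V) (0 : V)) :=
  W.comap (NormedSpace.fromTangentSpace (𝕜 := ℝ) (0 : V)).toLinearMap

end Euclidean

/-- `P` is a set of positive elements of the (reduced or non-reduced) root system `Φ`. -/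
structure IsPositiveSystem {V : Type*} [AddCommGroup V] (Φ P : Set V) : Prop where
  subset : P ⊆ Φ
  pos_or_neg : ∀ α ∈ Φ, Xor (α ∈ P) (-α ∈ P)
  add_mem : ∀ α ∈ P, ∀ β ∈ P, α + β ∈ Φ → α + β ∈ P

section Group

variable {n : ℕ} {G : Type*} [TopologicalSpace G] [Group G]
  [ChartedSpace (EuclideanSpace ℝ (Fin n)) G]

/-- The differential at the identity of a group homomorphism `f : G → G`, as a linear
endomorphism of the Lie algebra of `G` (recall that `f 1 = 1`). -/
def lieDifferential (f : G →* G) :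
    GroupLieAlgebra (𝓡 n) G →ₗ[ℝ] GroupLieAlgebra (𝓡 n) G :=
  (mfderiv (𝓡 n) (𝓡 n) f 1 : EuclideanSpace ℝ (Fin n) →L[ℝ] EuclideanSpace ℝ (Fin n)).toLinearMap

/-- The adjoint representation: `Ad g` is the differential at `1` of `h ↦ g h g⁻¹`. -/
def lieAd (g : G) : GroupLieAlgebra (𝓡 n) G →ₗ[ℝ] GroupLieAlgebra (𝓡 n) G :=
  lieDifferential (MulAut.conj g).toMonoidHom

variable [LieGroup (𝓡 n) ∞ G]

variable (n G) in
/-- A Riemannian symmetric pair `(G, K)` of compact type, with its involution `σ`. -/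
structure CompactSymmetricPair where
  /-- the involution of `G` -/
  σ : G →* G
  /-- the isotropy group -/
  K : Subgroup G
  σ_smooth : ContMDiff (𝓡 n) (𝓡 n) ∞ σ
  σ_involutive : ∀ g, σ (σ g) = g
  K_closed : IsClosed (K : Set G)
  /-- `K` is contained in the group of fixed points of `σ`. -/
  σ_fixes_K : ∀ k ∈ K, σ k = k
  /-- `K` contains the identity component of the group of fixed points of `σ`. -/
  fixed_component_le : connectedComponentIn {g : G | σ g = g} 1 ⊆ K
  /-- Compact type: the Killing form of the Lie algebra of `G` is negative definite. -/
  killing_neg : ∀ X : GroupLieAlgebra (𝓡 n) G, X ≠ 0 →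
    killingForm ℝ (GroupLieAlgebra (𝓡 n) G) X X < 0

namespace CompactSymmetricPair

variable (S : CompactSymmetricPair n G)

/-- The `-1` eigenspace `𝔭` of the involution `dσ`, as a subspace of the Lie algebra. -/
def pSubmodule : Submodule ℝ (GroupLieAlgebra (𝓡 n) G) :=
  Module.End.eigenspace (lieDifferential S.σ) (-1)

/-- The vector space `𝔭`, as a type of its own. It carries the Euclidean structure given by minus
the Killing form. -/
def P : Type := ↥S.pSubmodule

instance : AddCommGroup S.P := inferInstanceAs (AddCommGroup S.pSubmodule)

instance : Module ℝ S.P := inferInstanceAs (Module ℝ S.pSubmodule)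

/-- The inclusion of `𝔭` into the Lie algebra `𝔤`. -/
def incl : S.P →ₗ[ℝ] GroupLieAlgebra (𝓡 n) G := S.pSubmodule.subtype

theorem incl_injective : Function.Injective S.incl := Subtype.val_injective

/-- Minus the Killing form is an inner product on `𝔭`. -/
@[reducible] def innerCore : InnerProductSpace.Core ℝ S.P where
  inner X Y := -killingForm ℝ (GroupLieAlgebra (𝓡 n) G) (S.incl X) (S.incl Y)
  conj_inner_symm X Y := by
    change -_ = -_
    rw [LieModule.traceForm_comm]
  re_inner_nonneg X := by
    change 0 ≤ -_
    by_cases h : S.incl X = 0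
    · simp [h]
    · have := S.killing_neg _ h
      linarith
  add_left X Y Z := by
    simp only [map_add, LinearMap.add_apply]
    ring
  smul_left X Y r := by
    simp
  definite X h := by
    by_contra hX
    have h1 : S.incl X ≠ 0 := fun h0 => hX (S.incl_injective (by rw [h0, map_zero]))
    have h2 := S.killing_neg _ h1
    have h3 : -killingForm ℝ (GroupLieAlgebra (𝓡 n) G) (S.incl X) (S.incl X) = 0 := h
    linarith

instance : NormedAddCommGroup S.P := S.innerCore.toNormedAddCommGroup

instance : InnerProductSpace ℝ S.P := InnerProductSpace.ofCore S.innerCore.toCore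

/-- The orbit `Ad(K) x ⊆ 𝔭` (the maps `Ad k`, `k ∈ K`, commute with `dσ` and preserve `𝔭`). -/
def adOrbit (x : S.P) : Set S.P := {y | ∃ k ∈ S.K, S.incl y = lieAd k (S.incl x)}

/-- `𝔥` is a maximal abelian subspace of `𝔭`. -/
def IsMaximalAbelian (𝔥 : Submodule ℝ (GroupLieAlgebra (𝓡 n) G)) : Prop :=
  Maximal (fun 𝔟 : Submodule ℝ (GroupLieAlgebra (𝓡 n) G) =>
    𝔟 ≤ S.pSubmodule ∧ ∀ X ∈ 𝔟, ∀ Y ∈ 𝔟, ⁅X, Y⁆ = 0) 𝔥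

end CompactSymmetricPair

/-- `𝔤(α) = {X ∈ 𝔤 | [H, [H, X]] = -α(H)² X for all H ∈ 𝔥}`. -/
def rootSpaceG (𝔥 : Submodule ℝ (GroupLieAlgebra (𝓡 n) G)) (α : Module.Dual ℝ 𝔥) :
    Submodule ℝ (GroupLieAlgebra (𝓡 n) G) where
  carrier := {X | ∀ H : 𝔥, ⁅(H : GroupLieAlgebra (𝓡 n) G), ⁅(H : GroupLieAlgebra (𝓡 n) G), X⁆⁆ =
    (-((α H) ^ 2)) • X}
  add_mem' hX hY H := by rw [lie_add, lie_add, hX H, hY H, smul_add]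
  zero_mem' H := by rw [lie_zero, lie_zero, smul_zero]
  smul_mem' c X hX H := by rw [lie_smul, lie_smul, hX H, smul_comm]

/-- The restricted roots: the nonzero `α ∈ 𝔥*` with `𝔤(α) ≠ 0`. -/
def restrictedRoots (𝔥 : Submodule ℝ (GroupLieAlgebra (𝓡 n) G)) : Set (Module.Dual ℝ 𝔥) :=
  {α | α ≠ 0 ∧ rootSpaceG 𝔥 α ≠ ⊥}

/-- `𝔭(α) = 𝔤(α) ∩ 𝔭`, as a subspace of `𝔭`. -/
def CompactSymmetricPair.rootSpaceP (S : CompactSymmetricPair n G)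
    (𝔥 : Submodule ℝ (GroupLieAlgebra (𝓡 n) G)) (α : Module.Dual ℝ 𝔥) : Submodule ℝ S.P :=
  (rootSpaceG 𝔥 α).comap S.incl

end Group

end

/- Since the Killing form is invariant and definite, every `ad X` is semisimple, and `(ad H)²` is
symmetric on `𝔭` for `H ∈ 𝔭`. As `H` runs through `𝔥` these operators commute, so `𝔭` is the
orthogonal sum of their joint eigenspaces; each joint eigenvalue is minus the square of a linear
form on `𝔥`. Modulo the centralizer of `x`, only the `𝔭(α)` with `α x ≠ 0` survive.

If `X ∈ 𝔭(α)` and `α x ≠ 0`, then `X = [Z, x]` where `Z = (α x)⁻² [x, X]` is fixed by `dσ`, and `X`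
is the velocity at `0` of `Ad (exp (t Z)) x = exp (t ad Z) x`. The points `exp (t Z)` lie in `K`,
because they are fixed by `σ` and connected to `1`.

Conversely, let `v = [Z, x] + Y`, with `[x, Y] = 0`, be the velocity of a curve `γ` in the orbit
through `x`. The operators `ad (γ t)` are all conjugate to `ad x`, hence killed by one squarefree
polynomial `q`. Differentiating `q (ad (γ t)) = 0` gives `q' (ad x) * ad Y = 0`, where `q' (ad x)`
is invertible; hence `ad Y = 0` and `Y = 0`. -/

noncomputable section

section LinearAlgebra

theorem eq_or_eq_neg_of_forall_sq_eq {𝕜 V : Type*} [Field 𝕜] [Infinite 𝕜] [AddCommGroup V]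
    [Module 𝕜 V] {α β : Module.Dual 𝕜 V} (h : ∀ v, α v ^ 2 = β v ^ 2) : α = β ∨ α = -β := by
  by_contra! hne
  obtain ⟨v, hv⟩ := Module.Dual.exists_forall_ne_zero_of_forall_exists ![α - β, α + β] fun i => by
    by_contra! h0
    fin_cases i
    · exact hne.1 (sub_eq_zero.1 (LinearMap.ext h0))
    · exact hne.2 (eq_neg_of_add_eq_zero_left (LinearMap.ext h0))
  refine mul_ne_zero (hv 0) (hv 1) ?_
  change (α v - β v) * (α v + β v) = 0
  linear_combination h v

variable {V W : Type*} [AddCommGroup V] [Module ℝ V] [AddCommGroup W] [Module ℝ W]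

/- A nonpositive quadratic form `χ` is minus a square as soon as it satisfies
`χ u * χ u₀ = c u ^ 2`, where `c u = χ (u, u₀)` is its polarization at a `u₀` with `χ u₀ ≠ 0`. -/
theorem exists_dual_eq_neg_sq_of_forall_sq_eigenvector (T : V →ₗ[ℝ] Module.End ℝ W)
    (hT : ∀ u v, Commute (T u) (T v)) {χ : V → ℝ} (hχ : ∀ u, χ u ≤ 0) {X : W} (hX : X ≠ 0)
    (h : ∀ u, T u (T u X) = χ u • X) : ∃ α : Module.Dual ℝ V, ∀ u, χ u = -α u ^ 2 := by
  by_cases h0 : ∀ u, χ u = 0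
  · exact ⟨0, fun u => by simp [h0 u]⟩
  push Not at h0
  obtain ⟨u₀, hu₀⟩ := h0
  have hpos : 0 < -χ u₀ := neg_pos.2 (lt_of_le_of_ne (hχ u₀) hu₀)
  have hcomm : ∀ u v Y, T u (T v Y) = T v (T u Y) := fun u v Y =>
    LinearMap.congr_fun (hT u v) Y
  obtain ⟨c, hc⟩ : ∃ c : V → ℝ, ∀ u, T u (T u₀ X) = c u • X := by
    refine ⟨fun u => 2⁻¹ * (χ (u + u₀) - χ u - χ u₀), fun u => ?_⟩
    rw [mul_smul, sub_smul, sub_smul, ← h, ← h, ← h]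
    simp only [map_add, LinearMap.add_apply, hcomm u₀ u]
    module
  have hsq : ∀ u, χ u * χ u₀ = c u ^ 2 := fun u => by
    refine smul_left_injective ℝ hX ?_
    calc (χ u * χ u₀) • X = T u₀ (T u₀ (T u (T u X))) := by
          rw [h, map_smul, map_smul, h, smul_smul]
      _ = T u (T u₀ (T u (T u₀ X))) := by
          rw [hcomm u₀ u (T u X), hcomm u₀ u X, hcomm u₀ u]
      _ = c u ^ 2 • X := by
          rw [hc, map_smul, map_smul, hc, smul_smul, sq]
  obtain ⟨f, hf⟩ := Module.Projective.exists_dual_eq_one ℝ hX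
  refine ⟨(√(-χ u₀))⁻¹ • (f ∘ₗ T.flip (T u₀ X)), fun u => ?_⟩
  have hfc : f (T u (T u₀ X)) = c u := by rw [hc, map_smul, hf, smul_eq_mul, mul_one]
  simp only [LinearMap.smul_apply, LinearMap.comp_apply, LinearMap.flip_apply, hfc, smul_eq_mul,
    mul_pow, inv_pow, Real.sq_sqrt hpos.le, ← hsq u]
  field_simp

end LinearAlgebra

theorem commute_ad_of_lie_eq_zero {R L : Type*} [CommRing R] [LieRing L] [LieAlgebra R L] {x y : L}
    (h : ⁅x, y⁆ = 0) : Commute (LieAlgebra.ad R L x) (LieAlgebra.ad R L y) := by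
  refine LinearMap.ext fun z => ?_
  change ⁅x, ⁅y, z⁆⁆ = ⁅y, ⁅x, z⁆⁆
  rw [leibniz_lie, h, zero_lie, zero_add]

section NegativeKillingForm

variable {L : Type*} [LieRing L] [LieAlgebra ℝ L]
  (hK : ∀ X : L, X ≠ 0 → killingForm ℝ L X X < 0)

theorem killingForm_lie_lie_self (H X : L) :
    killingForm ℝ L ⁅H, X⁆ ⁅H, X⁆ = -killingForm ℝ L X ⁅H, ⁅H, X⁆⁆ :=
  LieModule.traceForm_apply_lie_apply' ℝ L L H X ⁅H, X⁆

include hK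

theorem isSemisimple_ad_of_killingForm_neg [Module.Finite ℝ L] (x : L) :
    (LieAlgebra.ad ℝ L x).IsSemisimple := by
  refine Module.End.isSemisimple_iff.2 fun p hp => ⟨(killingForm ℝ L).orthogonal p, ?_, ?_⟩
  · intro y hy z hz
    have hneg : killingForm ℝ L ⁅x, z⁆ y = -killingForm ℝ L z ⁅x, y⁆ :=
      LieModule.traceForm_apply_lie_apply' ℝ L L x z y
    exact neg_eq_zero.1 (hneg.symm.trans (hy _ (hp hz)))
  · refine (LinearMap.BilinForm.isCompl_orthogonal_iff_disjoint
      (LieModule.traceForm_isSymm ℝ L L).isRefl).2 (Submodule.disjoint_def.2 fun y hy hy' => ?_)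
    by_contra hne
    exact (hK y hne).ne (hy' y hy)

theorem lie_eq_zero_of_lie_lie_eq_zero {H X : L} (h : ⁅H, ⁅H, X⁆⁆ = 0) : ⁅H, X⁆ = 0 := by
  by_contra hne
  refine (hK _ hne).ne ?_
  rw [killingForm_lie_lie_self, h, map_zero, neg_zero]

theorem nonpos_of_lie_lie_eq_smul {H X : L} (hX : X ≠ 0) {c : ℝ} (h : ⁅H, ⁅H, X⁆⁆ = c • X) :
    c ≤ 0 := by
  have hnonpos : killingForm ℝ L ⁅H, X⁆ ⁅H, X⁆ ≤ 0 := by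
    by_cases h0 : ⁅H, X⁆ = 0
    · simp [h0]
    · exact (hK _ h0).le
  rw [killingForm_lie_lie_self, h, map_smul, smul_eq_mul] at hnonpos
  nlinarith [hK X hX]

theorem eq_zero_of_ad_eq_zero {X : L} (h : LieAlgebra.ad ℝ L X = 0) : X = 0 := by
  by_contra hne
  refine (hK X hne).ne ?_
  rw [killingForm_apply_apply, h, LinearMap.zero_comp, map_zero]

theorem exists_dual_eq_neg_sq_of_forall_lie_lie_eq_smul {𝔥 : Submodule ℝ L}
    (hab : ∀ X ∈ 𝔥, ∀ Y ∈ 𝔥, ⁅X, Y⁆ = 0) {χ : 𝔥 → ℝ} {X : L} (hX : X ≠ 0)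
    (h : ∀ H : 𝔥, ⁅(H : L), ⁅(H : L), X⁆⁆ = χ H • X) :
    ∃ α : Module.Dual ℝ 𝔥, ∀ H, χ H = -α H ^ 2 :=
  exists_dual_eq_neg_sq_of_forall_sq_eigenvector
    ((LieAlgebra.ad ℝ L : L →ₗ[ℝ] Module.End ℝ L) ∘ₗ 𝔥.subtype)
    (fun H H' => commute_ad_of_lie_eq_zero (hab H H.2 H' H'.2))
    (fun H => nonpos_of_lie_lie_eq_smul hK hX (h H)) hX h

end NegativeKillingForm

section Isospectral

section NormedAlgebra

variable {𝔸 : Type*} [NormedRing 𝔸] [NormedAlgebra ℝ 𝔸] {A : ℝ → 𝔸} {t : ℝ} {B C : 𝔸}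

theorem hasDerivAt_pow_of_commute (hC : Commute (A t) C)
    (hA : HasDerivAt A (B * A t - A t * B + C) t) (k : ℕ) :
    HasDerivAt (fun s => A s ^ k)
      (B * A t ^ k - A t ^ k * B + (k : ℝ) • (A t ^ (k - 1) * C)) t := by
  induction k with
  | zero => simpa using hasDerivAt_const t (1 : 𝔸)
  | succ k ih =>
    simp only [pow_succ]
    refine (ih.mul hA).congr_deriv ?_
    have hk : (k : ℝ) • (A t ^ (k - 1) * C) * A t = (k : ℝ) • (A t ^ k * C) := by
      cases k with
      | zero => simp
      | succ m => rw [smul_mul_assoc, mul_assoc, ← hC.eq, ← mul_assoc, Nat.add_sub_cancel, pow_succ]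
    rw [add_mul, hk, Nat.add_sub_cancel, Nat.cast_succ, add_smul, one_smul]
    noncomm_ring

theorem hasDerivAt_aeval_of_commute (hC : Commute (A t) C)
    (hA : HasDerivAt A (B * A t - A t * B + C) t) (q : Polynomial ℝ) :
    HasDerivAt (fun s => Polynomial.aeval (A s) q)
      (B * Polynomial.aeval (A t) q - Polynomial.aeval (A t) q * B +
        Polynomial.aeval (A t) (Polynomial.derivative q) * C) t := by
  induction q using Polynomial.induction_on' with
  | add p q hp hq =>
    simp only [map_add]
    refine (hp.add hq).congr_deriv ?_
    noncomm_ring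
  | monomial k a =>
    simp only [Polynomial.aeval_monomial, Polynomial.derivative_monomial, ← Algebra.smul_def]
    refine ((hasDerivAt_pow_of_commute hC hA k).const_smul a).congr_deriv ?_
    rw [smul_add, smul_sub, mul_smul_comm, smul_mul_assoc, smul_smul, smul_mul_assoc]

/- Differentiating `q (A s) = 0` gives `q' (A t) * C = 0`, and `q' (A t)` is invertible because `q`
is coprime to `q'`. -/
theorem eq_zero_of_commute_of_forall_aeval_eq_zero (hC : Commute (A t) C)
    (hA : HasDerivAt A (B * A t - A t * B + C) t) {q : Polynomial ℝ} (hq : Squarefree q)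
    (hq0 : ∀ s, Polynomial.aeval (A s) q = 0) : C = 0 := by
  have hderiv := hasDerivAt_aeval_of_commute hC hA q
  simp only [hq0] at hderiv
  have hC0 := hderiv.unique (hasDerivAt_const t (0 : 𝔸))
  simp only [mul_zero, zero_mul, sub_zero, zero_add] at hC0
  obtain ⟨u, w, huw⟩ := PerfectField.separable_iff_squarefree.2 hq
  have hone := congrArg (Polynomial.aeval (A t)) huw
  simp only [map_add, map_mul, hq0, mul_zero, zero_add, map_one] at hone
  rw [← one_mul C, ← hone, mul_assoc, hC0, mul_zero]

end NormedAlgebra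

theorem aeval_conj_eq_zero {R W : Type*} [CommRing R] [AddCommGroup W] [Module R W]
    {T : Module.End R W} {q : Polynomial R} (h : Polynomial.aeval T q = 0) (φ : W ≃ₗ[R] W) :
    Polynomial.aeval (φ.conj T) q = 0 :=
  (Polynomial.aeval_algHom_apply (φ.conjAlgEquiv R) T q).trans (by rw [h, map_zero])

theorem eq_zero_of_hasDerivAt_of_forall_conj {V W : Type*} [NormedAddCommGroup V]
    [NormedSpace ℝ V] [FiniteDimensional ℝ V] [AddCommGroup W] [Module ℝ W] [Module.Finite ℝ W]
    (T : V →ₗ[ℝ] Module.End ℝ W) {γ : ℝ → V} {t : ℝ} {v : V} (hγ : HasDerivAt γ v t)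
    (hss : (T (γ t)).IsSemisimple) (hconj : ∀ s, ∃ φ : W ≃ₗ[ℝ] W, T (γ s) = φ.conj (T (γ t)))
    {B C : Module.End ℝ W} (hC : Commute (T (γ t)) C)
    (hv : T v = B * T (γ t) - T (γ t) * B + C) : C = 0 := by
  let b := Module.finBasis ℝ W
  let e := LinearMap.toMatrixAlgEquiv b
  let _ : NormedRing (Matrix (Fin (Module.finrank ℝ W)) (Fin (Module.finrank ℝ W)) ℝ) :=
    Matrix.linftyOpNormedRing
  let _ : NormedAlgebra ℝ (Matrix (Fin (Module.finrank ℝ W)) (Fin (Module.finrank ℝ W)) ℝ) :=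
    Matrix.linftyOpNormedAlgebra
  have hA : HasDerivAt (fun s => e (T (γ s))) (e B * e (T (γ t)) - e (T (γ t)) * e B + e C) t := by
    rw [← map_mul, ← map_mul, ← map_sub, ← map_add, ← hv]
    exact (LinearMap.toContinuousLinearMap (e.toLinearMap ∘ₗ T)).hasFDerivAt.comp_hasDerivAt t hγ
  refine (map_eq_zero_iff e e.injective).1 <|
    eq_zero_of_commute_of_forall_aeval_eq_zero (hC.map e) hA hss.minpoly_squarefree fun s => ?_
  obtain ⟨φ, hφ⟩ := hconj s
  rw [Polynomial.aeval_algHom_apply, hφ, aeval_conj_eq_zero (minpoly.aeval ℝ _), map_zero]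

end Isospectral

theorem hasFDerivAt_of_mul_eventuallyEq {𝕜 E 𝔸 : Type*} [NontriviallyNormedField 𝕜]
    [NormedAddCommGroup E] [NormedSpace 𝕜 E] [NormedRing 𝔸] [NormedAlgebra 𝕜 𝔸] [CompleteSpace 𝔸]
    {a : E} {L R A : E → 𝔸} {L' R' : E →L[𝕜] 𝔸} (hL : HasFDerivAt L L' a)
    (hR : HasFDerivAt R R' a) (hLa : L a = 1) (hRa : R a = 1) (hA : ∀ᶠ x in 𝓝 a, R x * A x = L x) :
    HasFDerivAt A (L' - R') a := by
  have hinv : HasFDerivAt (fun x => Ring.inverse (R x)) (-R') a := by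
    have hone := hasFDerivAt_ringInverse (𝕜 := 𝕜) (1 : 𝔸ˣ)
    rw [Units.val_one, ← hRa] at hone
    convert! hone.comp a hR using 1
    ext; simp
  have hunit : ∀ᶠ x in 𝓝 a, IsUnit (R x) :=
    hR.continuousAt.eventually_mem (Units.isOpen.mem_nhds (by simp [hRa]))
  have hmul : HasFDerivAt (fun x => Ring.inverse (R x) * L x) (L' - R') a := by
    convert! hinv.mul' hL using 1
    ext v
    simp [hLa, hRa, sub_eq_add_neg]
  refine hmul.congr_of_eventuallyEq ?_
  filter_upwards [hunit, hA] with x hx hAx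
  rw [← hAx, Ring.inverse_mul_cancel_left _ _ hx]

section LocalGroup

open ContinuousLinearMap in
theorem hasFDerivAt_of_eventually_hasFDerivAt_comp {E E' F F' : Type*}
    [NormedAddCommGroup E] [NormedSpace ℝ E] [NormedAddCommGroup E'] [NormedSpace ℝ E']
    [NormedAddCommGroup F] [NormedSpace ℝ F] [NormedAddCommGroup F'] [NormedSpace ℝ F']
    {f : F → F'} {ι : E → E' → F} {a : E} {b : E'} {i : E →L[ℝ] F} {j : E' →L[ℝ] F}
    {L : E → E' →L[ℝ] F'} (hf : ContDiffAt ℝ 2 f (ι a b))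
    (hi : HasFDerivAt (fun x => ι x b) i a) (hj : ∀ x, HasFDerivAt (ι x) j b)
    (hL : ∀ᶠ x in 𝓝 a, HasFDerivAt (f ∘ ι x) (L x) b) :
    HasFDerivAt L (precomp F' j ∘L fderiv ℝ (fderiv ℝ f) (ι a b) ∘L i) a := by
  have hf' : HasFDerivAt (fderiv ℝ f) (fderiv ℝ (fderiv ℝ f) (ι a b)) (ι a b) :=
    ((hf.fderiv_right (m := 1) (by norm_num)).differentiableAt one_ne_zero).hasFDerivAt
  have hdiff : ∀ᶠ x in 𝓝 a, DifferentiableAt ℝ f (ι x b) :=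
    hi.continuousAt.eventually
      ((hf.eventually (by simp)).mono fun p hp => hp.differentiableAt two_ne_zero)
  refine ((precomp F' j).hasFDerivAt.comp a (hf'.comp a hi)).congr_of_eventuallyEq ?_
  filter_upwards [hL, hdiff] with x hLx hfx
  exact hLx.unique (hfx.hasFDerivAt.comp b (hj x))

/- In coordinates the group law is `m`, and `L x`, `R x`, `A x` are the differentials at the unit
`a` of left translation, right translation and conjugation by `x`. The symmetry of the second
derivative of `m` turns the derivative of `A` into the bracket of the left-invariant fields. -/
theorem exists_hasFDerivAt_eq_lieBracket {E : Type*} [NormedAddCommGroup E] [NormedSpace ℝ E]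
    [CompleteSpace E] {m : E × E → E} {a : E} (hm : ContDiffAt ℝ 2 m (a, a))
    {L R A : E → E →L[ℝ] E} (hL : ∀ᶠ x in 𝓝 a, HasFDerivAt (fun y => m (x, y)) (L x) a)
    (hR : ∀ᶠ x in 𝓝 a, HasFDerivAt (fun y => m (y, x)) (R x) a) (hLa : L a = 1) (hRa : R a = 1)
    (hA : ∀ᶠ x in 𝓝 a, R x * A x = L x) :
    ∃ A' : E →L[ℝ] E →L[ℝ] E, HasFDerivAt A A' a ∧
      ∀ Z X, A' Z X = VectorField.lieBracket ℝ (fun x => L x Z) (fun x => L x X) a := by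
  have hL' := hasFDerivAt_of_eventually_hasFDerivAt_comp (ι := Prod.mk) hm
    (hasFDerivAt_prodMk_left a a) (fun x => hasFDerivAt_prodMk_right x a) hL
  have hR' := hasFDerivAt_of_eventually_hasFDerivAt_comp (ι := fun x y => (y, x)) hm
    (hasFDerivAt_prodMk_right a a) (fun x => hasFDerivAt_prodMk_left a x) hR
  refine ⟨_, hasFDerivAt_of_mul_eventuallyEq hL' hR' hLa hRa hA, fun Z X => ?_⟩
  have hsymm : IsSymmSndFDerivAt ℝ m (a, a) := hm.isSymmSndFDerivAt (by simp)
  have hfield : ∀ V, fderiv ℝ (fun x => L x V) a = (ContinuousLinearMap.apply ℝ E V).comp _ :=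
    fun V => ((ContinuousLinearMap.apply ℝ E V).hasFDerivAt.comp a hL').fderiv
  rw [VectorField.lieBracket, hfield, hfield, hLa]
  simp [hsymm.eq (X, 0) (0, Z)]

end LocalGroup

theorem eq_exp_smul_of_hasDerivAt_mul {𝔸 : Type*} [NormedRing 𝔸] [NormedAlgebra ℝ 𝔸]
    [CompleteSpace 𝔸] {A : ℝ → 𝔸} {a : 𝔸} {ε : ℝ}
    (hA : ∀ t ∈ Set.Ioo (-ε) ε, HasDerivAt A (A t * a) t) (hA0 : A 0 = 1) {t : ℝ}
    (ht : t ∈ Set.Ioo (-ε) ε) : A t = NormedSpace.exp (t • a) := by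
  let _ : NormedAlgebra ℚ 𝔸 := NormedAlgebra.restrictScalars ℚ ℝ 𝔸
  have h0 : (0 : ℝ) ∈ Set.Ioo (-ε) ε := ⟨by linarith [ht.1, ht.2], by linarith [ht.1, ht.2]⟩
  have hderiv : ∀ s ∈ Set.Ioo (-ε) ε,
      HasDerivAt (fun s => A s * NormedSpace.exp (s • -a)) 0 s := by
    intro s hs
    refine ((hA s hs).mul (hasDerivAt_exp_smul_const' (-a) s)).congr_deriv ?_
    noncomm_ring
  have hconst : A t * NormedSpace.exp (t • -a) = 1 := by
    rw [isOpen_Ioo.is_const_of_deriv_eq_zero isPreconnected_Ioo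
      (fun s hs => (hderiv s hs).differentiableAt.differentiableWithinAt)
      (fun s hs => (hderiv s hs).deriv) ht h0, hA0, zero_smul, NormedSpace.exp_zero, mul_one]
  calc A t = A t * NormedSpace.exp (t • -a + t • a) := by simp
    _ = A t * NormedSpace.exp (t • -a) * NormedSpace.exp (t • a) := by
      rw [NormedSpace.exp_add_of_commute (((Commute.refl a).neg_left.smul_left t).smul_right t),
        mul_assoc]
    _ = NormedSpace.exp (t • a) := by rw [hconst, one_mul]

section ExpCurve

variable {F : Type*} [NormedAddCommGroup F] [NormedSpace ℝ F]

theorem exp_zero_smul_apply (a : F →L[ℝ] F) (y : F) : NormedSpace.exp ((0 : ℝ) • a) y = y := by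
  rw [zero_smul, NormedSpace.exp_zero, one_apply_eq_self]

variable [CompleteSpace F]

theorem contDiff_exp_smul_apply (a : F →L[ℝ] F) (y : F) {m : WithTop ℕ∞} :
    ContDiff ℝ m (fun t : ℝ => NormedSpace.exp (t • a) y) := by
  have hexp : ContDiff ℝ m (NormedSpace.exp : (F →L[ℝ] F) → F →L[ℝ] F) :=
    AnalyticOnNhd.contDiff fun b _ => NormedSpace.exp_analytic b
  exact (hexp.comp (contDiff_id.smul contDiff_const)).clm_apply contDiff_const

theorem hasDerivAt_exp_smul_apply_zero (a : F →L[ℝ] F) (y : F) :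
    HasDerivAt (fun t : ℝ => NormedSpace.exp (t • a) y) (a y) 0 := by
  simpa using (hasDerivAt_exp_smul_const a (0 : ℝ)).clm_apply (hasDerivAt_const 0 y)

end ExpCurve

section LieGroup

variable {E H : Type*} [NormedAddCommGroup E] [NormedSpace ℝ E] [TopologicalSpace H]
  {I : ModelWithCorners ℝ E H} {G : Type*} [TopologicalSpace G] [ChartedSpace H G] [Group G]

theorem hasFDerivAt_comp_extChartAt_symm {M F : Type*} [TopologicalSpace M] [ChartedSpace H M]
    [NormedAddCommGroup F] [NormedSpace ℝ F] [I.Boundaryless] {f : M → F} {x : M} {f' : E →L[ℝ] F}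
    (hf : HasMFDerivAt I 𝓘(ℝ, F) f x f') :
    HasFDerivAt (f ∘ (extChartAt I x).symm) f' (extChartAt I x x) := by
  have h := hf.2
  rw [I.range_eq_univ] at h
  exact hasFDerivWithinAt_univ.mp h

variable (I G) in
/-- The group law of `G`, read in the preferred chart at `1`. -/
def chartMul (p : E × E) : E :=
  extChartAt I (1 : G) ((extChartAt I (1 : G)).symm p.1 * (extChartAt I (1 : G)).symm p.2)

theorem contDiffAt_chartMul [I.Boundaryless] {n : WithTop ℕ∞} [LieGroup I n G] :
    ContDiffAt ℝ n (chartMul I G) (extChartAt I (1 : G) 1, extChartAt I (1 : G) 1) := by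
  have : IsManifold I n G := ContMDiffMul.toIsManifold
  set φ := extChartAt I (1 : G)
  have hsymm : ContMDiffAt 𝓘(ℝ, E) I n φ.symm (φ 1) :=
    (contMDiffOn_extChartAt_symm 1).contMDiffAt (extChartAt_target_mem_nhds 1)
  have hfst : ContMDiffAt 𝓘(ℝ, E × E) I n (fun p => φ.symm p.1) (φ 1, φ 1) :=
    ContMDiffAt.comp (φ 1, φ 1) (g := φ.symm) hsymm contDiffAt_fst.contMDiffAt
  have hsnd : ContMDiffAt 𝓘(ℝ, E × E) I n (fun p => φ.symm p.2) (φ 1, φ 1) :=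
    ContMDiffAt.comp (φ 1, φ 1) (g := φ.symm) hsymm contDiffAt_snd.contMDiffAt
  refine ContMDiffAt.contDiffAt (contMDiffAt_extChartAt.comp_of_eq (hfst.mul hsnd) ?_)
  simp only [φ, extChartAt_to_inv, mul_one]

section Adjoint

variable [LieGroup I (minSmoothness ℝ 3) G] {E' H' : Type*} [NormedAddCommGroup E']
  [NormedSpace ℝ E'] [TopologicalSpace H'] {I' : ModelWithCorners ℝ E' H'} {G' : Type*}
  [TopologicalSpace G'] [ChartedSpace H' G'] [Group G'] [LieGroup I' (minSmoothness ℝ 3) G']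
  {f : G →* G'} {D : GroupLieAlgebra I G →L[ℝ] GroupLieAlgebra I' G'}

theorem mdifferentiable_mul_left_lieGroup (g : G) : MDifferentiable I I (g * ·) :=
  (contMDiff_mul_left (n := minSmoothness ℝ 3)).mdifferentiable (by simp)

theorem mdifferentiable_mul_right_lieGroup (g : G) : MDifferentiable I I (· * g) :=
  (contMDiff_mul_right (n := minSmoothness ℝ 3)).mdifferentiable (by simp)

theorem mdifferentiable_conj (g : G) : MDifferentiable I I (MulAut.conj g).toMonoidHom :=
  (mdifferentiable_mul_right_lieGroup g⁻¹).comp (mdifferentiable_mul_left_lieGroup g)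

variable (I G) in
/-- The adjoint representation, on the model space `E` of the Lie algebra so that it takes its
values in a normed algebra. -/
def adjointRep : G →* (E →L[ℝ] E) where
  toFun g := mfderiv I I (MulAut.conj g).toMonoidHom 1
  map_one' :=
    hasMFDerivAt_unique (mdifferentiable_conj (1 : G) 1).hasMFDerivAt
      ((hasMFDerivAt_id 1).congr_of_eventuallyEq (.of_forall fun x => by simp))
  map_mul' g h := by
    have hg : HasMFDerivAt I I (MulAut.conj g).toMonoidHom ((MulAut.conj h).toMonoidHom 1)
        (mfderiv I I (MulAut.conj g).toMonoidHom 1 : E →L[ℝ] E) := by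
      rw [map_one]
      exact (mdifferentiable_conj g 1).hasMFDerivAt
    exact hasMFDerivAt_unique (mdifferentiable_conj (g * h) 1).hasMFDerivAt
      ((hg.comp 1 (mdifferentiable_conj h 1).hasMFDerivAt).congr_of_eventuallyEq
        (.of_forall fun x => by simp))

theorem hasMFDerivAt_conj (g : G) :
    HasMFDerivAt I I (MulAut.conj g).toMonoidHom 1 (adjointRep I G g) :=
  (mdifferentiable_conj g 1).hasMFDerivAt

theorem map_adjointRep_of_hasMFDerivAt (hf : HasMFDerivAt I I' f 1 D) (g : G)
    (X : GroupLieAlgebra I G) : D (adjointRep I G g X) = adjointRep I' G' (f g) (D X) := by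
  have hleft : HasMFDerivAt I I' f ((MulAut.conj g).toMonoidHom 1) D := by rwa [map_one]
  have hright : HasMFDerivAt I' I' (MulAut.conj (f g)).toMonoidHom (f 1)
      (adjointRep I' G' (f g) : E' →L[ℝ] E') := by
    rw [map_one]
    exact hasMFDerivAt_conj (f g)
  have h := hasMFDerivAt_unique (hleft.comp 1 (hasMFDerivAt_conj g))
    ((hright.comp 1 hf).congr_of_eventuallyEq (.of_forall fun h => by simp))
  exact congrArg (fun T : E →L[ℝ] E' => T X) h

theorem mfderiv_mulInvariantVectorField (hf : HasMFDerivAt I I' f 1 D) {g : G}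
    (hg : MDifferentiableAt I I' f g) (X : GroupLieAlgebra I G) :
    mfderiv I I' f g (mulInvariantVectorField X g) = mulInvariantVectorField (D X) (f g) := by
  have hleft : HasMFDerivAt I I' f (g * 1) (mfderiv I I' f g : E →L[ℝ] E') := by
    rw [mul_one]
    exact hg.hasMFDerivAt
  have hright : HasMFDerivAt I' I' (f g * ·) (f 1)
      (mfderiv I' I' (f g * ·) (1 : G') : E' →L[ℝ] E') := by
    rw [map_one]
    exact (mdifferentiable_mul_left_lieGroup (f g) 1).hasMFDerivAt
  have h := hasMFDerivAt_unique
    (hleft.comp 1 (mdifferentiable_mul_left_lieGroup g 1).hasMFDerivAt)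
    ((hright.comp 1 hf).congr_of_eventuallyEq (.of_forall (map_mul f g)))
  exact congrArg (fun T : E →L[ℝ] E' => T X) h

theorem contMDiff_one_mulInvariantVectorField (Z : GroupLieAlgebra I G) :
    ContMDiff I I.tangent 1
      (fun g : G => (⟨g, mulInvariantVectorField Z g⟩ : TangentBundle I G)) :=
  (contMDiff_mulInvariantVectorField Z).of_le
    (le_trans (by norm_num) (le_minSmoothness (𝕜 := ℝ) (n := 2)))

theorem isMIntegralCurveOn_map (hf : MDifferentiable I I' f) (hD : HasMFDerivAt I I' f 1 D)
    {Z : GroupLieAlgebra I G} {c : ℝ → G} {s : Set ℝ}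
    (hc : IsMIntegralCurveOn c (mulInvariantVectorField (I := I) Z) s) :
    IsMIntegralCurveOn (f ∘ c) (mulInvariantVectorField (I := I') (D Z)) s := by
  intro t ht
  refine HasMFDerivWithinAt.congr_mfderiv
    ((hf (c t)).hasMFDerivAt.comp_hasMFDerivWithinAt t (hc t ht)) ?_
  refine ContinuousLinearMap.ext_ring ?_
  change (mfderiv I I' f (c t) : E →L[ℝ] E') ((1 : ℝ) • (mulInvariantVectorField Z (c t) : E)) =
    (1 : ℝ) • (mulInvariantVectorField (D Z) (f (c t)) : E')
  rw [one_smul, one_smul]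
  exact mfderiv_mulInvariantVectorField hD (hf (c t)) Z

theorem isManifold_one_of_lieGroup : IsManifold I 1 G :=
  have : IsManifold I (minSmoothness ℝ 3) G := ContMDiffMul.toIsManifold
  IsManifold.of_le (n := minSmoothness ℝ 3) (by simp)

theorem mem_connectedComponentIn_fixedPoints [I.Boundaryless] [T2Space G] {σ : G →* G}
    {D : GroupLieAlgebra I G →L[ℝ] GroupLieAlgebra I G} (hσ : MDifferentiable I I σ)
    (hD : HasMFDerivAt I I σ 1 D) {Z : GroupLieAlgebra I G} {c : ℝ → G} {ε : ℝ}
    (hZ : D Z = Z) (hc0 : c 0 = 1)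
    (hc : IsMIntegralCurveOn c (mulInvariantVectorField (I := I) Z) (Set.Ioo (-ε) ε)) {t : ℝ}
    (ht : t ∈ Set.Ioo (-ε) ε) : c t ∈ connectedComponentIn {g : G | σ g = g} 1 := by
  have := isManifold_one_of_lieGroup (I := I) (G := G)
  have h0 : (0 : ℝ) ∈ Set.Ioo (-ε) ε := ⟨by linarith [ht.1, ht.2], by linarith [ht.1, ht.2]⟩
  have hσc := isMIntegralCurveOn_map hσ hD hc
  rw [hZ] at hσc
  have hfix : Set.EqOn (σ ∘ c) c (Set.Ioo (-ε) ε) :=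
    isMIntegralCurveOn_Ioo_eqOn_of_contMDiff_boundaryless h0
      (contMDiff_one_mulInvariantVectorField Z) hσc hc (by simp [hc0])
  have himage : c '' Set.Ioo (-ε) ε ⊆ connectedComponentIn {g : G | σ g = g} 1 :=
    (isPreconnected_Ioo.image c hc.continuousOn).subset_connectedComponentIn ⟨0, h0, hc0⟩
      (Set.image_subset_iff.2 hfix)
  exact himage (Set.mem_image_of_mem c ht)

variable (I G) in
/-- The differential at `1` of left translation by the point with coordinates `x`, with values
read in the preferred chart at `1`. -/
def chartLeft (x : E) : E →L[ℝ] E :=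
  mfderiv I 𝓘(ℝ, E)
    (fun h => extChartAt I (1 : G) ((extChartAt I (1 : G)).symm x * h)) 1

variable (I G) in
/-- The differential at `1` of right translation by the point with coordinates `x`, with values
read in the preferred chart at `1`. -/
def chartRight (x : E) : E →L[ℝ] E :=
  mfderiv I 𝓘(ℝ, E)
    (fun h => extChartAt I (1 : G) (h * (extChartAt I (1 : G)).symm x)) 1

theorem mdifferentiableAt_extChartAt_mul_left {g : G} (hg : g ∈ (chartAt H (1 : G)).source) :
    MDifferentiableAt I 𝓘(ℝ, E) (fun h => extChartAt I (1 : G) (g * h)) 1 :=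
  have := isManifold_one_of_lieGroup (I := I) (G := G)
  (mdifferentiableAt_extChartAt hg).comp_of_eq 1 (mdifferentiable_mul_left_lieGroup g 1)
    (mul_one g)

theorem mdifferentiableAt_extChartAt_mul_right {g : G} (hg : g ∈ (chartAt H (1 : G)).source) :
    MDifferentiableAt I 𝓘(ℝ, E) (fun h => extChartAt I (1 : G) (h * g)) 1 :=
  have := isManifold_one_of_lieGroup (I := I) (G := G)
  (mdifferentiableAt_extChartAt hg).comp_of_eq 1 (mdifferentiable_mul_right_lieGroup g 1)
    (one_mul g)

theorem eventually_extChartAt_symm_mem_source [I.Boundaryless] {M : Type*} [TopologicalSpace M]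
    [ChartedSpace H M] (x : M) :
    ∀ᶠ y in 𝓝 (extChartAt I x x), (extChartAt I x).symm y ∈ (chartAt H x).source := by
  filter_upwards [extChartAt_target_mem_nhds x] with y hy
  simpa using (extChartAt I x).map_target hy

theorem hasFDerivAt_chartMul_right [I.Boundaryless] :
    ∀ᶠ x in 𝓝 (extChartAt I (1 : G) 1),
      HasFDerivAt (fun y => chartMul I G (x, y)) (chartLeft I G x) (extChartAt I (1 : G) 1) := by
  filter_upwards [eventually_extChartAt_symm_mem_source (1 : G)] with x hx
  exact hasFDerivAt_comp_extChartAt_symm (mdifferentiableAt_extChartAt_mul_left hx).hasMFDerivAt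

theorem hasFDerivAt_chartMul_left [I.Boundaryless] :
    ∀ᶠ x in 𝓝 (extChartAt I (1 : G) 1),
      HasFDerivAt (fun y => chartMul I G (y, x)) (chartRight I G x) (extChartAt I (1 : G) 1) := by
  filter_upwards [eventually_extChartAt_symm_mem_source (1 : G)] with x hx
  exact hasFDerivAt_comp_extChartAt_symm (mdifferentiableAt_extChartAt_mul_right hx).hasMFDerivAt

theorem hasMFDerivAt_extChartAt_self {M : Type*} [TopologicalSpace M] [ChartedSpace H M]
    [IsManifold I 1 M] (x : M) : HasMFDerivAt I 𝓘(ℝ, E) (extChartAt I x) x (1 : E →L[ℝ] E) :=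
  (mdifferentiableAt_extChartAt (mem_chart_source H x)).hasMFDerivAt.congr_mfderiv
    mfderiv_extChartAt_self

theorem chartLeft_self : chartLeft I G (extChartAt I (1 : G) 1) = 1 := by
  have := isManifold_one_of_lieGroup (I := I) (G := G)
  refine ((hasMFDerivAt_extChartAt_self (I := I) (1 : G)).congr_of_eventuallyEq ?_).mfderiv
  exact .of_forall fun h => by simp

theorem chartRight_self : chartRight I G (extChartAt I (1 : G) 1) = 1 := by
  have := isManifold_one_of_lieGroup (I := I) (G := G)
  refine ((hasMFDerivAt_extChartAt_self (I := I) (1 : G)).congr_of_eventuallyEq ?_).mfderiv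
  exact .of_forall fun h => by simp

theorem chartRight_mul_adjointRep [I.Boundaryless] :
    ∀ᶠ x in 𝓝 (extChartAt I (1 : G) 1),
      chartRight I G x * adjointRep I G ((extChartAt I (1 : G)).symm x) = chartLeft I G x := by
  filter_upwards [eventually_extChartAt_symm_mem_source (1 : G)] with x hx
  set g := (extChartAt I (1 : G)).symm x
  have hright : HasMFDerivAt I 𝓘(ℝ, E) (fun h => extChartAt I (1 : G) (h * g))
      ((MulAut.conj g).toMonoidHom 1) (chartRight I G x : E →L[ℝ] E) := by
    rw [map_one]
    exact (mdifferentiableAt_extChartAt_mul_right hx).hasMFDerivAt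
  refine hasMFDerivAt_unique ((hright.comp 1 (hasMFDerivAt_conj g)).congr_of_eventuallyEq ?_)
    (mdifferentiableAt_extChartAt_mul_left hx).hasMFDerivAt
  exact .of_forall fun h => by simp [g]

theorem mpullbackWithin_extChartAt_symm_mulInvariantVectorField [I.Boundaryless]
    (X : GroupLieAlgebra I G) :
    ∀ᶠ x in 𝓝 (extChartAt I (1 : G) 1),
      VectorField.mpullbackWithin 𝓘(ℝ, E) I (extChartAt I (1 : G)).symm
        (mulInvariantVectorField X) (Set.range I) x = chartLeft I G x X := by
  have := isManifold_one_of_lieGroup (I := I) (G := G)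
  filter_upwards [extChartAt_target_mem_nhds (I := I) (1 : G),
    eventually_extChartAt_symm_mem_source (1 : G)] with x hx hgs
  rw [VectorField.mpullbackWithin_apply, ContinuousLinearMap.inverse_eq
    (mfderivWithin_extChartAt_symm_comp_mfderiv_extChartAt hx)
    (mfderiv_extChartAt_comp_mfderivWithin_extChartAt_symm hx)]
  exact (mfderiv_comp_apply_of_eq (x := 1) (mdifferentiableAt_extChartAt hgs)
    (mdifferentiable_mul_left_lieGroup _ 1) (mul_one _) X).symm

theorem lie_eq_lieBracket_chartLeft [I.Boundaryless] (Z X : GroupLieAlgebra I G) :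
    ⁅Z, X⁆ = VectorField.lieBracket ℝ (fun x => chartLeft I G x Z) (fun x => chartLeft I G x X)
      (extChartAt I (1 : G) 1) := by
  have := isManifold_one_of_lieGroup (I := I) (G := G)
  have hinv : (mfderiv I 𝓘(ℝ, E) (extChartAt I (1 : G)) 1 : E →L[ℝ] E).inverse = .id ℝ E := by
    rw [mfderiv_extChartAt_self]
    exact ContinuousLinearMap.inverse_id
  rw [GroupLieAlgebra.bracket_def, ← VectorField.mlieBracketWithin_univ,
    VectorField.mlieBracketWithin_apply, Set.preimage_univ, Set.univ_inter]
  refine (congrArg (fun T : E →L[ℝ] E => T _) hinv).trans ?_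
  have h := Filter.EventuallyEq.lieBracket_vectorField_eq (𝕜 := ℝ)
    (mpullbackWithin_extChartAt_symm_mulInvariantVectorField Z)
    (mpullbackWithin_extChartAt_symm_mulInvariantVectorField X)
  rw [I.range_eq_univ] at h ⊢
  exact (congrFun VectorField.lieBracketWithin_univ _).trans h

theorem exists_hasFDerivAt_adjointRep [I.Boundaryless] [CompleteSpace E] :
    ∃ A' : E →L[ℝ] E →L[ℝ] E,
      HasFDerivAt (fun x => adjointRep I G ((extChartAt I (1 : G)).symm x)) A'
        (extChartAt I (1 : G) 1) ∧ ∀ Z X : GroupLieAlgebra I G, A' Z X = ⁅Z, X⁆ := by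
  have : LieGroup I 2 G := LieGroup.of_le (n := minSmoothness ℝ 3)
    ((by norm_cast : (2 : WithTop ℕ∞) ≤ 3).trans le_minSmoothness)
  obtain ⟨A', hA', hlie⟩ := exists_hasFDerivAt_eq_lieBracket contDiffAt_chartMul
    hasFDerivAt_chartMul_right hasFDerivAt_chartMul_left (chartLeft_self (I := I) (G := G))
    chartRight_self chartRight_mul_adjointRep
  exact ⟨A', hA', fun Z X => (hlie Z X).trans (lie_eq_lieBracket_chartLeft Z X).symm⟩

theorem exists_hasMFDerivAt_adjointRep_one [I.Boundaryless] [CompleteSpace E] :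
    ∃ A' : E →L[ℝ] E →L[ℝ] E, HasMFDerivAt I 𝓘(ℝ, E →L[ℝ] E) (adjointRep I G) 1 A' ∧
      ∀ Z X : GroupLieAlgebra I G, A' Z X = ⁅Z, X⁆ := by
  have := isManifold_one_of_lieGroup (I := I) (G := G)
  obtain ⟨A', hA', hlie⟩ := exists_hasFDerivAt_adjointRep (I := I) (G := G)
  refine ⟨A', ?_, hlie⟩
  refine (hA'.hasMFDerivAt.comp 1 (hasMFDerivAt_extChartAt_self 1)).congr_of_eventuallyEq ?_
  filter_upwards [extChartAt_source_mem_nhds (I := I) (1 : G)] with g hg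
  exact congrArg (adjointRep I G) ((extChartAt I (1 : G)).left_inv hg).symm

variable (I G) in
/-- The differential at `1` of the adjoint representation, again on the model space: this is `ad`,
see `adjointDeriv_apply`. -/
def adjointDeriv : E →L[ℝ] E →L[ℝ] E :=
  mfderiv I 𝓘(ℝ, E →L[ℝ] E) (adjointRep I G) 1

section Complete

variable [I.Boundaryless] [CompleteSpace E]

theorem hasMFDerivAt_adjointRep_one :
    HasMFDerivAt I 𝓘(ℝ, E →L[ℝ] E) (adjointRep I G) 1
      (adjointDeriv I G : E →L[ℝ] E →L[ℝ] E) :=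
  have ⟨_, hA', _⟩ := exists_hasMFDerivAt_adjointRep_one (I := I) (G := G)
  hA'.mdifferentiableAt.hasMFDerivAt

theorem adjointDeriv_apply (Z X : GroupLieAlgebra I G) : adjointDeriv I G Z X = ⁅Z, X⁆ := by
  obtain ⟨A', hA', hlie⟩ := exists_hasMFDerivAt_adjointRep_one (I := I) (G := G)
  have h := hasMFDerivAt_unique hasMFDerivAt_adjointRep_one hA'
  exact (congrArg (fun T : E →L[ℝ] E →L[ℝ] E => T Z X) h).trans (hlie Z X)

theorem map_lie_of_hasMFDerivAt [I'.Boundaryless] [CompleteSpace E'] (hf : HasMFDerivAt I I' f 1 D)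
    (X Y : GroupLieAlgebra I G) : D ⁅X, Y⁆ = ⁅D X, D Y⁆ := by
  let D : E →L[ℝ] E' := D
  have hAd : HasMFDerivAt I' 𝓘(ℝ, E' →L[ℝ] E') (adjointRep I' G') (f 1)
      (adjointDeriv I' G' : E' →L[ℝ] E' →L[ℝ] E') := by
    rw [map_one]
    exact hasMFDerivAt_adjointRep_one
  have hleft : HasMFDerivAt I 𝓘(ℝ, E →L[ℝ] E') (fun g => D ∘L adjointRep I G g) 1
      (ContinuousLinearMap.compL ℝ E E E' D ∘L adjointDeriv I G : E →L[ℝ] E →L[ℝ] E') :=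
    (ContinuousLinearMap.compL ℝ E E E' D).hasMFDerivAt.comp 1 hasMFDerivAt_adjointRep_one
  have hright : HasMFDerivAt I 𝓘(ℝ, E →L[ℝ] E') (fun g => adjointRep I' G' (f g) ∘L D) 1
      (ContinuousLinearMap.precomp E' D ∘L adjointDeriv I' G' ∘L D : E →L[ℝ] E →L[ℝ] E') :=
    (ContinuousLinearMap.precomp E' D).hasMFDerivAt.comp 1 (hAd.comp 1 hf)
  have h := hasMFDerivAt_unique hleft (hright.congr_of_eventuallyEq (.of_forall fun g =>
    ContinuousLinearMap.ext (map_adjointRep_of_hasMFDerivAt hf g)))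
  rw [← adjointDeriv_apply X Y]
  exact (congrArg (fun T : E →L[ℝ] E →L[ℝ] E' => T X Y) h).trans (adjointDeriv_apply _ _)

theorem mdifferentiable_adjointRep :
    MDifferentiable I 𝓘(ℝ, E →L[ℝ] E) (adjointRep I G) := fun g => by
  have hAd : MDifferentiableAt I 𝓘(ℝ, E →L[ℝ] E) (fun h => adjointRep I G (g⁻¹ * h)) g :=
    hasMFDerivAt_adjointRep_one.mdifferentiableAt.comp_of_eq g
      (mdifferentiable_mul_left_lieGroup g⁻¹ g) (inv_mul_cancel g)
  have hmul : MDifferentiable 𝓘(ℝ, E →L[ℝ] E) 𝓘(ℝ, E →L[ℝ] E) (adjointRep I G g * ·) :=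
    (differentiable_id.const_mul (adjointRep I G g)).mdifferentiable
  refine ((hmul _).comp g hAd).congr_of_eventuallyEq (.of_forall fun h => ?_)
  simp [← map_mul]

theorem hasDerivAt_adjointRep_comp {c : ℝ → G} {t : ℝ} {Z : GroupLieAlgebra I G}
    (hc : HasMFDerivAt 𝓘(ℝ, ℝ) I c t
      ((1 : ℝ →L[ℝ] ℝ).smulRight (mulInvariantVectorField Z (c t)))) :
    HasDerivAt (fun s => adjointRep I G (c s)) (adjointRep I G (c t) * adjointDeriv I G Z) t := by
  let D : E →L[ℝ] E →L[ℝ] E := mfderiv I 𝓘(ℝ, E →L[ℝ] E) (adjointRep I G) (c t)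
  have hD : HasMFDerivAt I 𝓘(ℝ, E →L[ℝ] E) (adjointRep I G) (c t) D :=
    (mdifferentiable_adjointRep (c t)).hasMFDerivAt
  have htranslate : HasMFDerivAt I 𝓘(ℝ, E →L[ℝ] E) (adjointRep I G) (c t * 1) D := by
    rwa [mul_one]
  have hmul : HasMFDerivAt I 𝓘(ℝ, E →L[ℝ] E) (fun h => adjointRep I G (c t) * adjointRep I G h) 1
      (ContinuousLinearMap.mul ℝ (E →L[ℝ] E) (adjointRep I G (c t)) ∘L adjointDeriv I G :
        E →L[ℝ] E →L[ℝ] E) :=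
    (ContinuousLinearMap.mul ℝ (E →L[ℝ] E) (adjointRep I G (c t))).hasMFDerivAt.comp 1
      hasMFDerivAt_adjointRep_one
  have hchain := hasMFDerivAt_unique
    (htranslate.comp 1 (mdifferentiable_mul_left_lieGroup (c t) 1).hasMFDerivAt)
    (hmul.congr_of_eventuallyEq (.of_forall fun h => map_mul _ _ _))
  have h : HasFDerivAt (fun s => adjointRep I G (c s))
      (D ∘L (1 : ℝ →L[ℝ] ℝ).smulRight (mulInvariantVectorField Z (c t) : E)) t :=
    (hD.comp t hc).hasFDerivAt
  have hZ : D (mulInvariantVectorField Z (c t)) = adjointRep I G (c t) * adjointDeriv I G Z :=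
    congrArg (fun T : E →L[ℝ] E →L[ℝ] E => T Z) hchain
  refine h.hasDerivAt.congr_deriv ?_
  rw [← hZ]
  exact congrArg D (one_smul ℝ (mulInvariantVectorField Z (c t) : E))

section IntegralCurve

variable {Z : GroupLieAlgebra I G} {c : ℝ → G} {ε : ℝ}

theorem exists_isMIntegralCurveOn_mulInvariantVectorField (Z : GroupLieAlgebra I G) :
    ∃ ε > 0, ∃ c : ℝ → G, c 0 = 1 ∧
      IsMIntegralCurveOn c (mulInvariantVectorField (I := I) Z) (Set.Ioo (-ε) ε) := by
  have := isManifold_one_of_lieGroup (I := I) (G := G)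
  obtain ⟨c, hc0, hc⟩ := exists_isMIntegralCurveAt_of_contMDiffAt_boundaryless (t₀ := 0)
    (contMDiff_one_mulInvariantVectorField Z).contMDiffAt
  obtain ⟨ε, hε, hcε⟩ := isMIntegralCurveAt_iff'.1 hc
  rw [Real.ball_eq_Ioo, zero_sub, zero_add] at hcε
  exact ⟨ε, hε, c, hc0, hcε⟩

theorem adjointRep_eq_exp_smul (hc0 : c 0 = 1)
    (hc : IsMIntegralCurveOn c (mulInvariantVectorField (I := I) Z) (Set.Ioo (-ε) ε)) {t : ℝ}
    (ht : t ∈ Set.Ioo (-ε) ε) :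
    adjointRep I G (c t) = NormedSpace.exp (t • adjointDeriv I G Z) :=
  eq_exp_smul_of_hasDerivAt_mul
    (fun s hs => hasDerivAt_adjointRep_comp ((hc s hs).hasMFDerivAt (isOpen_Ioo.mem_nhds hs)))
    (by rw [hc0, map_one]) ht

theorem exists_mem_adjointRep_eq_exp_smul [T2Space G] {σ : G →* G}
    {D : GroupLieAlgebra I G →L[ℝ] GroupLieAlgebra I G} (hσ : MDifferentiable I I σ)
    (hD : HasMFDerivAt I I σ 1 D) {K : Subgroup G}
    (hK : connectedComponentIn {g : G | σ g = g} 1 ⊆ K) (hZ : D Z = Z) (t : ℝ) :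
    ∃ k ∈ K, adjointRep I G k = NormedSpace.exp (t • adjointDeriv I G Z) := by
  let _ : NormedAlgebra ℚ (E →L[ℝ] E) := NormedAlgebra.restrictScalars ℚ ℝ _
  obtain ⟨ε, hε, c, hc0, hc⟩ := exists_isMIntegralCurveOn_mulInvariantVectorField Z
  obtain ⟨m, hm⟩ := exists_nat_gt (|t| / ε)
  have hm0 : (0 : ℝ) < m := (div_nonneg (abs_nonneg t) hε.le).trans_lt hm
  have ht : t / m ∈ Set.Ioo (-ε) ε := by
    rw [Set.mem_Ioo, ← abs_lt, abs_div, Nat.abs_cast, div_lt_iff₀ hm0, mul_comm]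
    rwa [div_lt_iff₀ hε] at hm
  refine ⟨c (t / m) ^ m,
    pow_mem (hK (mem_connectedComponentIn_fixedPoints hσ hD hZ hc0 hc ht)) m, ?_⟩
  rw [map_pow, adjointRep_eq_exp_smul hc0 hc ht, ← NormedSpace.exp_nsmul,
    ← Nat.cast_smul_eq_nsmul ℝ, smul_smul, mul_div_cancel₀ t hm0.ne']

end IntegralCurve

end Complete

end Adjoint

end LieGroup

section SymmetricPair

variable {n : ℕ} {G : Type*} [TopologicalSpace G] [Group G]
  [ChartedSpace (EuclideanSpace ℝ (Fin n)) G] [LieGroup (𝓡 n) ∞ G]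

instance : Module.Finite ℝ (GroupLieAlgebra (𝓡 n) G) :=
  inferInstanceAs (Module.Finite ℝ (EuclideanSpace ℝ (Fin n)))

/-- `Ad g` as an automorphism of the Lie algebra. -/
def lieAdEquiv (g : G) : GroupLieAlgebra (𝓡 n) G ≃ₗ⁅ℝ⁆ GroupLieAlgebra (𝓡 n) G where
  __ := lieAd g
  map_lie' := map_lie_of_hasMFDerivAt (hasMFDerivAt_conj g) _ _
  invFun := lieAd g⁻¹
  left_inv X := by
    have h : adjointRep (𝓡 n) G g⁻¹ * adjointRep (𝓡 n) G g = 1 := by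
      rw [← map_mul, inv_mul_cancel, map_one]
    exact congrArg (fun T : EuclideanSpace ℝ (Fin n) →L[ℝ] EuclideanSpace ℝ (Fin n) => T X) h
  right_inv X := by
    have h : adjointRep (𝓡 n) G g * adjointRep (𝓡 n) G g⁻¹ = 1 := by
      rw [← map_mul, mul_inv_cancel, map_one]
    exact congrArg (fun T : EuclideanSpace ℝ (Fin n) →L[ℝ] EuclideanSpace ℝ (Fin n) => T X) h

namespace CompactSymmetricPair

variable (S : CompactSymmetricPair n G) {𝔥 : Submodule ℝ (GroupLieAlgebra (𝓡 n) G)}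

instance : FiniteDimensional ℝ S.P := inferInstanceAs (FiniteDimensional ℝ S.pSubmodule)

theorem mdifferentiable_σ : MDifferentiable (𝓡 n) (𝓡 n) S.σ :=
  S.σ_smooth.mdifferentiable (by simp)

theorem lieDifferential_σ_lie (X Y : GroupLieAlgebra (𝓡 n) G) :
    lieDifferential S.σ ⁅X, Y⁆ = ⁅lieDifferential S.σ X, lieDifferential S.σ Y⁆ :=
  map_lie_of_hasMFDerivAt (S.mdifferentiable_σ 1).hasMFDerivAt X Y

theorem mem_pSubmodule {X : GroupLieAlgebra (𝓡 n) G} :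
    X ∈ S.pSubmodule ↔ lieDifferential S.σ X = -X := by
  rw [pSubmodule, Module.End.mem_eigenspace_iff, neg_smul, one_smul]

theorem incl_mem (X : S.P) : S.incl X ∈ S.pSubmodule := X.2

theorem lieDifferential_σ_lie_of_mem {X Y : GroupLieAlgebra (𝓡 n) G} (hX : X ∈ S.pSubmodule)
    (hY : Y ∈ S.pSubmodule) : lieDifferential S.σ ⁅X, Y⁆ = ⁅X, Y⁆ := by
  rw [lieDifferential_σ_lie, S.mem_pSubmodule.1 hX, S.mem_pSubmodule.1 hY, neg_lie, lie_neg,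
    neg_neg]

theorem lie_lie_mem_pSubmodule {H X : GroupLieAlgebra (𝓡 n) G} (hH : H ∈ S.pSubmodule)
    (hX : X ∈ S.pSubmodule) : ⁅H, ⁅H, X⁆⁆ ∈ S.pSubmodule := by
  rw [mem_pSubmodule, lieDifferential_σ_lie, S.lieDifferential_σ_lie_of_mem hH hX,
    S.mem_pSubmodule.1 hH, neg_lie]

theorem lieAd_mem_pSubmodule {k : G} (hk : S.σ k = k) {X : GroupLieAlgebra (𝓡 n) G}
    (hX : X ∈ S.pSubmodule) : lieAd k X ∈ S.pSubmodule := by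
  have h : lieDifferential S.σ (lieAd k X) = lieAd (S.σ k) (lieDifferential S.σ X) :=
    map_adjointRep_of_hasMFDerivAt (S.mdifferentiable_σ 1).hasMFDerivAt k X
  rw [mem_pSubmodule, h, hk, S.mem_pSubmodule.1 hX, map_neg]

/-- The operator `X ↦ [H, [H, X]]` on `𝔭`, for `H ∈ 𝔭`; the spaces `𝔭(α)` are its joint
eigenspaces as `H` runs through `𝔥`. -/
def adSq (H : S.pSubmodule) : Module.End ℝ S.P :=
  LinearMap.restrict (p := S.pSubmodule) (q := S.pSubmodule)
    (LieAlgebra.ad ℝ (GroupLieAlgebra (𝓡 n) G) (H : GroupLieAlgebra (𝓡 n) G) ^ 2)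
    (fun _ hX => S.lie_lie_mem_pSubmodule H.2 hX)

variable (H : S.pSubmodule)

theorem incl_adSq (X : S.P) :
    S.incl (S.adSq H X) =
      ⁅(H : GroupLieAlgebra (𝓡 n) G), ⁅(H : GroupLieAlgebra (𝓡 n) G), S.incl X⁆⁆ :=
  rfl

theorem isSymmetric_adSq : (S.adSq H).IsSymmetric := by
  intro X Y
  change -killingForm ℝ _ (S.incl (S.adSq H X)) (S.incl Y) =
    -killingForm ℝ _ (S.incl X) (S.incl (S.adSq H Y))
  rw [incl_adSq, incl_adSq, killingForm, LieModule.traceForm_apply_lie_apply',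
    LieModule.traceForm_apply_lie_apply', neg_neg]

theorem commute_adSq {H H' : S.pSubmodule}
    (h : ⁅(H : GroupLieAlgebra (𝓡 n) G), (H' : GroupLieAlgebra (𝓡 n) G)⁆ = 0) :
    Commute (S.adSq H) (S.adSq H') :=
  LinearMap.ext fun X => S.incl_injective <|
    LinearMap.congr_fun ((commute_ad_of_lie_eq_zero h).pow_pow 2 2).eq (S.incl X)

theorem rootSpaceP_eq_iInf_eigenspace (h𝔭 : 𝔥 ≤ S.pSubmodule) (α : Module.Dual ℝ 𝔥) :
    S.rootSpaceP 𝔥 α =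
      ⨅ H : 𝔥, Module.End.eigenspace (S.adSq (Submodule.inclusion h𝔭 H)) (-(α H) ^ 2) := by
  ext X
  simp only [Submodule.mem_iInf, Module.End.mem_eigenspace_iff, ← S.incl_injective.eq_iff,
    incl_adSq, map_smul]
  rfl

theorem iSupIndep_rootSpaceP (h𝔭 : 𝔥 ≤ S.pSubmodule) {ι : Type*} {β : ι → Module.Dual ℝ 𝔥}
    (hβ : Pairwise fun i j => β i ≠ β j ∧ β i ≠ -β j) :
    iSupIndep (fun i => S.rootSpaceP 𝔥 (β i)) := by
  have hinj : Function.Injective (fun (i : ι) (H : 𝔥) => -(β i H) ^ 2) := by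
    intro i j h
    by_contra hij
    have hsq (H : 𝔥) : β i H ^ 2 = β j H ^ 2 := neg_injective (congrFun h H)
    exact (eq_or_eq_neg_of_forall_sq_eq hsq).elim (hβ hij).1 (hβ hij).2
  simp only [S.rootSpaceP_eq_iInf_eigenspace h𝔭]
  exact (LinearMap.IsSymmetric.orthogonalFamily_iInf_eigenspaces
    fun H => S.isSymmetric_adSq (Submodule.inclusion h𝔭 H)).independent.comp hinj

theorem rootSpaceP_neg (α : Module.Dual ℝ 𝔥) : S.rootSpaceP 𝔥 (-α) = S.rootSpaceP 𝔥 α := by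
  ext X
  simp [rootSpaceP, rootSpaceG]

theorem mem_iSup_rootSpaceP_sup (h𝔭 : 𝔥 ≤ S.pSubmodule) (hab : ∀ X ∈ 𝔥, ∀ Y ∈ 𝔥, ⁅X, Y⁆ = 0)
    {Φpos : Set (Module.Dual ℝ 𝔥)} (hpos : ∀ α ∈ restrictedRoots 𝔥, α ∈ Φpos ∨ -α ∈ Φpos)
    {x : S.P} (hx : S.incl x ∈ 𝔥) (v : S.P) :
    v ∈ (⨆ α : {α : Module.Dual ℝ 𝔥 // α ∈ Φpos ∧ α ⟨S.incl x, hx⟩ ≠ 0}, S.rootSpaceP 𝔥 α.1) ⊔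
      LinearMap.ker (LieAlgebra.ad ℝ (GroupLieAlgebra (𝓡 n) G) (S.incl x) ∘ₗ S.incl) := by
  have htop := LinearMap.IsSymmetric.iSup_iInf_eq_top_of_commute
    (fun H : 𝔥 => S.isSymmetric_adSq (Submodule.inclusion h𝔭 H))
    (fun H H' _ => S.commute_adSq (hab H H.2 H' H'.2))
  refine SetLike.le_def.1 (htop.ge.trans (iSup_le fun χ X hX => ?_)) Submodule.mem_top
  obtain rfl | hX0 := eq_or_ne X 0
  · exact zero_mem _
  have hχ (H : 𝔥) : ⁅(H : GroupLieAlgebra (𝓡 n) G), ⁅(H : GroupLieAlgebra (𝓡 n) G), S.incl X⁆⁆ =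
      χ H • S.incl X :=
    congrArg S.incl (Module.End.mem_eigenspace_iff.1 (Submodule.mem_iInf _ |>.1 hX H))
  have hinclX : S.incl X ≠ 0 := (map_ne_zero_iff _ S.incl_injective).2 hX0
  obtain ⟨α, hα⟩ := exists_dual_eq_neg_sq_of_forall_lie_lie_eq_smul S.killing_neg hab hinclX hχ
  obtain rfl : χ = fun H => -α H ^ 2 := funext hα
  by_cases hαx : α ⟨S.incl x, hx⟩ = 0
  · refine Submodule.mem_sup_right (lie_eq_zero_of_lie_lie_eq_zero S.killing_neg ?_)
    simpa [hαx] using hχ ⟨S.incl x, hx⟩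
  · have hroot : α ∈ restrictedRoots 𝔥 :=
      ⟨fun h0 => hαx (by rw [h0, LinearMap.zero_apply]),
        (Submodule.ne_bot_iff _).2 ⟨S.incl X, hχ, hinclX⟩⟩
    refine Submodule.mem_sup_left ?_
    obtain hα | hα := hpos α hroot
    · exact Submodule.mem_iSup_of_mem ⟨α, hα, hαx⟩ hχ
    · refine Submodule.mem_iSup_of_mem ⟨-α, hα, neg_ne_zero.2 hαx⟩ ?_
      rw [rootSpaceP_neg]
      exact hχ

theorem exists_lie_eq_of_mem_iSup_rootSpaceP (Φpos : Set (Module.Dual ℝ 𝔥)) {x : S.P}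
    (hx : S.incl x ∈ 𝔥) {v : S.P}
    (hv : v ∈ ⨆ α : {α : Module.Dual ℝ 𝔥 // α ∈ Φpos ∧ α ⟨S.incl x, hx⟩ ≠ 0},
      S.rootSpaceP 𝔥 α.1) :
    ∃ Z : GroupLieAlgebra (𝓡 n) G, lieDifferential S.σ Z = Z ∧ S.incl v = ⁅Z, S.incl x⁆ := by
  induction hv using Submodule.iSup_induction' with
  | mem α X hX =>
    have hxx : ⁅S.incl x, ⁅S.incl x, S.incl X⁆⁆ = (-(α.1 ⟨S.incl x, hx⟩) ^ 2) • S.incl X :=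
      hX ⟨S.incl x, hx⟩
    refine ⟨((α.1 ⟨S.incl x, hx⟩) ^ 2)⁻¹ • ⁅S.incl x, S.incl X⁆, ?_, ?_⟩
    · rw [map_smul, S.lieDifferential_σ_lie_of_mem (S.incl_mem x) (S.incl_mem X)]
    · rw [smul_lie, ← lie_skew, hxx, ← neg_smul, neg_neg, smul_smul,
        inv_mul_cancel₀ (pow_ne_zero 2 α.2.2), one_smul]
  | zero => exact ⟨0, map_zero _, by rw [map_zero, zero_lie]⟩
  | add X Y _ _ hX hY =>
    obtain ⟨Z, hZ, hZX⟩ := hX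
    obtain ⟨W, hW, hWY⟩ := hY
    exact ⟨Z + W, by rw [map_add, hZ, hW], by rw [map_add, add_lie, hZX, hWY]⟩

theorem eq_zero_of_hasDerivAt_adOrbit {γ : ℝ → S.P} {x v : S.P} (horb : ∀ t, γ t ∈ S.adOrbit x)
    (hγ0 : γ 0 = x) (hγ : HasDerivAt γ v 0) {Y Z : GroupLieAlgebra (𝓡 n) G}
    (hY : ⁅S.incl x, Y⁆ = 0) (hv : S.incl v = ⁅Z, S.incl x⁆ + Y) : Y = 0 := by
  let ad : GroupLieAlgebra (𝓡 n) G →ₗ[ℝ] Module.End ℝ (GroupLieAlgebra (𝓡 n) G) :=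
    LieAlgebra.ad ℝ (GroupLieAlgebra (𝓡 n) G)
  refine eq_zero_of_ad_eq_zero S.killing_neg
    (eq_zero_of_hasDerivAt_of_forall_conj (ad ∘ₗ S.incl) (B := ad Z) hγ
      (isSemisimple_ad_of_killingForm_neg S.killing_neg _) (fun s => ?_) ?_ ?_)
  · obtain ⟨k, -, hk⟩ := horb s
    refine ⟨(lieAdEquiv k).toLinearEquiv, ?_⟩
    rw [hγ0]
    exact (congrArg ad hk).trans (LieAlgebra.conj_ad_apply (lieAdEquiv k) (S.incl x)).symm
  · rw [hγ0]
    exact commute_ad_of_lie_eq_zero hY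
  · rw [hγ0]
    refine LinearMap.ext fun W => ?_
    change ⁅S.incl v, W⁆ = ⁅Z, ⁅S.incl x, W⁆⁆ - ⁅S.incl x, ⁅Z, W⁆⁆ + ⁅Y, W⁆
    rw [hv, add_lie, lie_lie]

theorem mem_iSup_rootSpaceP_of_hasDerivAt_adOrbit (h𝔭 : 𝔥 ≤ S.pSubmodule)
    (hab : ∀ X ∈ 𝔥, ∀ Y ∈ 𝔥, ⁅X, Y⁆ = 0) {Φpos : Set (Module.Dual ℝ 𝔥)}
    (hpos : ∀ α ∈ restrictedRoots 𝔥, α ∈ Φpos ∨ -α ∈ Φpos) {x : S.P} (hx : S.incl x ∈ 𝔥)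
    {γ : ℝ → S.P} {v : S.P} (horb : ∀ t, γ t ∈ S.adOrbit x) (hγ0 : γ 0 = x)
    (hγ : HasDerivAt γ v 0) :
    v ∈ ⨆ α : {α : Module.Dual ℝ 𝔥 // α ∈ Φpos ∧ α ⟨S.incl x, hx⟩ ≠ 0}, S.rootSpaceP 𝔥 α.1 := by
  obtain ⟨u, hu, Y, hY, rfl⟩ := Submodule.mem_sup.1 (S.mem_iSup_rootSpaceP_sup h𝔭 hab hpos hx v)
  obtain ⟨Z, -, hZ⟩ := S.exists_lie_eq_of_mem_iSup_rootSpaceP Φpos hx hu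
  have hY0 : S.incl Y = 0 :=
    S.eq_zero_of_hasDerivAt_adOrbit horb hγ0 hγ hY (by rw [map_add, hZ])
  rwa [(map_eq_zero_iff _ S.incl_injective).1 hY0, add_zero]

theorem exists_contDiff_adOrbit [T2Space G] {Z : GroupLieAlgebra (𝓡 n) G}
    (hZ : lieDifferential S.σ Z = Z) {x v : S.P} (hv : S.incl v = ⁅Z, S.incl x⁆) :
    ∃ γ : ℝ → S.P, ContDiff ℝ ∞ γ ∧ (∀ t, γ t ∈ S.adOrbit x) ∧ γ 0 = x ∧ HasDerivAt γ v 0 := by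
  obtain ⟨r, hr⟩ := LinearMap.exists_leftInverse_of_injective S.incl
    (LinearMap.ker_eq_bot.2 S.incl_injective)
  let p : EuclideanSpace ℝ (Fin n) →L[ℝ] S.P :=
    LinearMap.toContinuousLinearMap (E := EuclideanSpace ℝ (Fin n)) r
  have hpincl (X : S.P) : p (S.incl X) = X := LinearMap.congr_fun hr X
  let a : EuclideanSpace ℝ (Fin n) →L[ℝ] EuclideanSpace ℝ (Fin n) := adjointDeriv (𝓡 n) G Z
  let y : EuclideanSpace ℝ (Fin n) := S.incl x
  refine ⟨fun t => p (NormedSpace.exp (t • a) y), p.contDiff.comp (contDiff_exp_smul_apply a y),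
    fun t => ?_, ?_, ?_⟩
  · obtain ⟨k, hk, hAd⟩ := exists_mem_adjointRep_eq_exp_smul S.mdifferentiable_σ
      (S.mdifferentiable_σ 1).hasMFDerivAt S.fixed_component_le hZ t
    have hmem : lieAd k (S.incl x) ∈ S.pSubmodule :=
      S.lieAd_mem_pSubmodule (S.σ_fixes_K k hk) (S.incl_mem x)
    have hlieAd : NormedSpace.exp (t • a) y = lieAd k (S.incl x) :=
      congrArg (fun T : EuclideanSpace ℝ (Fin n) →L[ℝ] EuclideanSpace ℝ (Fin n) => T y) hAd.symm
    refine ⟨k, hk, ?_⟩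
    change S.incl (p (NormedSpace.exp (t • a) y)) = _
    rw [hlieAd]
    exact congrArg S.incl (hpincl ⟨lieAd k (S.incl x), hmem⟩)
  · exact (congrArg p (exp_zero_smul_apply a y)).trans (hpincl x)
  · have hpa : p (a y) = v := by
      rw [← hpincl v, hv]
      exact congrArg p (adjointDeriv_apply Z (S.incl x))
    rw [← hpa]
    exact p.hasFDerivAt.comp_hasDerivAt 0 (hasDerivAt_exp_smul_apply_zero a y)

end CompactSymmetricPair

end SymmetricPair

end

theorem mainTheorem4_general {n : ℕ} {G : Type*} [TopologicalSpace G] [T2Space G] [Group G]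
    [ChartedSpace (EuclideanSpace ℝ (Fin n)) G] [LieGroup (𝓡 n) ∞ G]
    (S : CompactSymmetricPair n G) (𝔥 : Submodule ℝ (GroupLieAlgebra (𝓡 n) G))
    (h𝔭 : 𝔥 ≤ S.pSubmodule) (hab : ∀ X ∈ 𝔥, ∀ Y ∈ 𝔥, ⁅X, Y⁆ = 0)
    (Φpos : Set (Module.Dual ℝ 𝔥)) (hneg : ∀ α ∈ Φpos, -α ∉ Φpos)
    (hpos : ∀ α ∈ restrictedRoots 𝔥, α ∈ Φpos ∨ -α ∈ Φpos) (x : S.P) (hx : S.incl x ∈ 𝔥) :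
    iSupIndep (fun α : {α : Module.Dual ℝ 𝔥 // α ∈ Φpos ∧ α ⟨S.incl x, hx⟩ ≠ 0} =>
      S.rootSpaceP 𝔥 α.1) ∧
    submanifoldTangentSpace (S.adOrbit x) x =
      euclideanParallelTransport 0 x ''
        ((⨆ α : {α : Module.Dual ℝ 𝔥 // α ∈ Φpos ∧ α ⟨S.incl x, hx⟩ ≠ 0},
          S.rootSpaceP 𝔥 α.1).atZero : Set (TangentSpace 𝓘(ℝ, S.P) (0 : S.P))) := by
  refine ⟨S.iSupIndep_rootSpaceP h𝔭 fun α β hαβ =>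
    ⟨Subtype.coe_ne_coe.2 hαβ, fun h => hneg β.1 β.2.1 (h ▸ α.2.1)⟩, ?_⟩
  ext v
  constructor
  · rintro ⟨γ, -, horb, hγ0, hγ⟩
    exact ⟨v, S.mem_iSup_rootSpaceP_of_hasDerivAt_adOrbit h𝔭 hab hpos hx horb hγ0 hγ, rfl⟩
  · rintro ⟨w, hw, rfl⟩
    obtain ⟨Z, hZ, hZw⟩ := S.exists_lie_eq_of_mem_iSup_rootSpaceP Φpos hx hw
    exact S.exists_contDiff_adOrbit hZ hZw

theorem mainTheorem4 {n : ℕ} {G : Type*} [TopologicalSpace G] [T2Space G] [ConnectedSpace G]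
    [Group G] [ChartedSpace (EuclideanSpace ℝ (Fin n)) G] [LieGroup (𝓡 n) ∞ G]
    (S : CompactSymmetricPair n G)
    (𝔥 : Submodule ℝ (GroupLieAlgebra (𝓡 n) G)) (h𝔥 : S.IsMaximalAbelian 𝔥)
    (Φpos : Set (Module.Dual ℝ 𝔥)) (hΦ : IsPositiveSystem (restrictedRoots 𝔥) Φpos)
    (x : S.P) (hx : S.incl x ∈ 𝔥) :
    iSupIndep (fun α : {α : Module.Dual ℝ 𝔥 // α ∈ Φpos ∧ α ⟨S.incl x, hx⟩ ≠ 0} =>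
      S.rootSpaceP 𝔥 α.1) ∧
    submanifoldTangentSpace (S.adOrbit x) x =
      euclideanParallelTransport 0 x ''
        ((⨆ α : {α : Module.Dual ℝ 𝔥 // α ∈ Φpos ∧ α ⟨S.incl x, hx⟩ ≠ 0},
          S.rootSpaceP 𝔥 α.1).atZero : Set (TangentSpace 𝓘(ℝ, S.P) (0 : S.P))) := by
  exact mainTheorem4_general S 𝔥 h𝔥.prop.1 h𝔥.prop.2 Φpos
    (fun α hα h => (hΦ.pos_or_neg α (hΦ.subset hα)).elim (fun h' => h'.2 h) (fun h' => h'.2 hα))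
    (fun α hα => (hΦ.pos_or_neg α hα).or) x hx
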